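/- Let $\mathbb{C}=A_0\subset A_1\subset A_2\subset\cdots$ be a tower of finite-dimensional unital associative $\mathbb{C}$-algebras (unital inclusions). Write $\mathrm{Ind}_n=A_{n+1}\otimes_{A_n}-$ and $\mathrm{Res}_n$ for induction and restriction between finite-dimensional left modules of $A_n$ and $A_{n+1}$. Assume that the tower is a free Frobenius tower: for every $n\ge 0$, $\mathrm{Res}_n$ is left adjoint to $\mathrm{Ind}_n$ (so that the two functors are biadjoint), and $A_{n+1}$ is free as a right $A_n$-module. Let $\Gamma_n$ be the set of isomorphism classes of simple $A_n$-modules and $\Gamma=\bigsqcup_{n\ge0}\Gamma_n$. For $\mu\in\Gamma_n$ let $L^\mu$ be the corresponding simple module and $P^\mu$ its projective cover. For $\mu\in\Gamma_n$, $\lambda\in\Gamma_{n+1}$ define integers $\kappa(\mu,\lambda)$, $\kappa^*(\mu,\lambda)$ by $$[\mathrm{Ind}_n P^\mu]=\sum_{\lambda\in\Gamma_{n+1}}\kappa(\mu,\lambda)[P^\lambda],\qquad [\mathrm{Ind}_n L^\mu]=\sum_{\lambda\in\Gamma_{n+1}}\kappa^*(\mu,\lambda)[L^\lambda]$$ in,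 respectively, the split Grothendieck group $K_0$ of finite-dimensional projective $A_{n+1}$-modules and the Grothendieck group $G_0$ of finite-dimensional $A_{n+1}$-modules; set $\kappa=\kappa^*=0$ on all other pairs in $\Gamma\times\Gamma$. Let $G_\Gamma$ (resp. $G_\Gamma^*$) be the graded graph with vertex set $\Gamma$, $n$-th graded component $\Gamma_n$, and an edge from $\mu\in\Gamma_n$ to $\lambda\in\Gamma_{n+1}$ exactly when $\kappa(\mu,\lambda)>0$ (resp. $\kappa^*(\mu,\lambda)>0$). For $\mu\in\Gamma_n$ put $$Pl_n(\mu)=\frac{\dim(L^\mu)\dim(P^\mu)}{\dim(A_n)},$$ and for $\mu,\eta\in\Gamma$ put $$p_\downarrow(\mu,\eta)=\frac{\kappa(\eta,\mu)\dim(L^\eta)}{\dim(L^\mu)},\qquad p^*_\downarrow(\mu,\eta)=\frac{\kappa^*(\eta,\mu)\dim(P^\eta)}{\dim(P^\mu)} .$$ For a graded graph with components $V_0,V_1,\dots$ and vertex set $V$, a down transition function is a map $p:V\times V\to[0,1]$ such that $p(\lambda,\mu)>0$ if and only if $\lambda\in V_{n+1}$, $\mu\in V_n$ for some $n$ and $\mu,\lambda$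 are joined by an edge, and such that $\sum_{\mu\in V_n}p(\lambda,\mu)=1$ for all $n\ge0$ and $\lambda\in V_{n+1}$. Strictly positive probability measures $M_n$ on $V_n$ $(n\ge0)$ are coherent with respect to $p$ if $\sum_{\lambda\in V_{n+1}}M_{n+1}(\lambda)\,p(\lambda,\mu)=M_n(\mu)$ for all $n\ge0$ and $\mu\in V_n$. Then $p_\downarrow$ is a down transition function on $G_\Gamma$, $p^*_\downarrow$ is a down transition function on $G_\Gamma^*$, each $Pl_n$ is a strictly positive probability measure on $\Gamma_n$, and the measures $\{Pl_n\}_{n\ge0}$ are coherent with respect to $p_\downarrow$ on $G_\Gamma$ and with respect to $p_\downarrow^*$ on $G_\Gamma^*$. -/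

import Mathlib

open CategoryTheory
open scoped TensorProduct

universe u

noncomputable section

/-! ## Induction and restriction along a ring homomorphism -/

namespace FrobTower

section Induction

variable {A B : Type u} [Ring A] [Ring B] (φ : A →+* B)

/-- The `B`-submodule of `B ⊗_ℤ M` spanned by the elements `b φ(a) ⊗ m - b ⊗ a m`. -/
def balancedRel (M : Type u) [AddCommGroup M] [Module A M] : Submodule B (B ⊗[ℤ] M) :=
  Submodule.span B
    {x | ∃ (b : B) (a : A) (m : M), x = (b * φ a) ⊗ₜ[ℤ] m - b ⊗ₜ[ℤ] (a • m)}

/-- The left `B`-module `B ⊗_A M` over a (noncommutative) ring `A`, where `B` is a right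
`A`-module through `φ : A → B`. -/
abbrev IndMod (M : Type u) [AddCommGroup M] [Module A M] : Type u :=
  (B ⊗[ℤ] M) ⧸ balancedRel φ M

section Lift

variable {M : Type u} [AddCommGroup M] [Module A M]

/-- The pure tensor `b ⊗ m` in `B ⊗_A M`. -/
def indTmul (b : B) (m : M) : IndMod φ M := (balancedRel φ M).mkQ (b ⊗ₜ[ℤ] m)

theorem indTmul_balanced (b : B) (a : A) (m : M) :
    indTmul φ (b * φ a) m = indTmul φ b (a • m) := by
  unfold indTmul
  rw [← sub_eq_zero, ← map_sub, Submodule.mkQ_apply, Submodule.Quotient.mk_eq_zero]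
  exact Submodule.subset_span ⟨b, a, m, rfl⟩

theorem smul_indTmul (c b : B) (m : M) : c • indTmul φ b m = indTmul φ (c * b) m := by
  unfold indTmul
  rw [← map_smul, TensorProduct.smul_tmul', smul_eq_mul]

theorem indTmul_add (b : B) (m m' : M) :
    indTmul φ b (m + m') = indTmul φ b m + indTmul φ b m' := by
  unfold indTmul
  rw [TensorProduct.tmul_add, map_add]

variable {φ} in
theorem ind_hom_ext {F : Type u} [AddCommGroup F] [Module B F] {f g : IndMod φ M →ₗ[B] F}
    (h : ∀ m, f (indTmul φ 1 m) = g (indTmul φ 1 m)) : f = g := by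
  apply Submodule.linearMap_qext
  refine LinearMap.ext fun x => ?_
  induction x using TensorProduct.induction_on with
  | zero => simp
  | add x y hx hy => rw [map_add, map_add, hx, hy]
  | tmul b m =>
    have e : b ⊗ₜ[ℤ] m = b • ((1 : B) ⊗ₜ[ℤ] m) := by
      rw [TensorProduct.smul_tmul', smul_eq_mul, mul_one]
    rw [e, map_smul, map_smul]
    exact congrArg (b • ·) (h m)

/-- The universal property of `B ⊗_A M`: a `φ`-semilinear map `M → F` to a `B`-module extends
uniquely to a `B`-linear map `B ⊗_A M → F`. -/
def indLift {F : Type u} [AddCommGroup F] [Module B F] (h : M →ₛₗ[φ] F) :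
    IndMod φ M →ₗ[B] F :=
  (balancedRel φ M).liftQ
    (TensorProduct.AlgebraTensorModule.lift
      { toFun := fun b =>
          { toFun := fun m => b • h m
            map_add' := fun m m' => by rw [map_add, smul_add]
            map_smul' := fun z m => by
              rw [map_zsmul, RingHom.id_apply, smul_comm] }
        map_add' := fun b b' => by
          ext m
          exact add_smul b b' (h m)
        map_smul' := fun c b => by
          ext m
          exact mul_smul c b (h m) })
    (by
      unfold balancedRel
      rw [Submodule.span_le]
      rintro _ ⟨b, a, m, rfl⟩
      rw [SetLike.mem_coe, LinearMap.mem_ker, map_sub, sub_eq_zero]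
      simp [mul_smul])

@[simp]
theorem indLift_tmul {F : Type u} [AddCommGroup F] [Module B F] (h : M →ₛₗ[φ] F)
    (b : B) (m : M) : indLift φ h (indTmul φ b m) = b • h m := by
  simp [indLift, indTmul]

/-- The map `m ↦ 1 ⊗ m`. -/
def indUnit (M : Type u) [AddCommGroup M] [Module A M] : M →ₛₗ[φ] IndMod φ M where
  toFun m := indTmul φ 1 m
  map_add' := indTmul_add φ 1
  map_smul' a m := by
    rw [smul_indTmul, mul_one, ← indTmul_balanced, one_mul]

/-- Functoriality of `B ⊗_A M` in `M`: the map `b ⊗ m ↦ b ⊗ f m`. -/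
def indMap {N : Type u} [AddCommGroup N] [Module A N] (f : M →ₗ[A] N) :
    IndMod φ M →ₗ[B] IndMod φ N :=
  indLift φ ((indUnit φ N).comp f)

@[simp]
theorem indMap_one_tmul {N : Type u} [AddCommGroup N] [Module A N] (f : M →ₗ[A] N) (m : M) :
    indMap φ f (indTmul φ 1 m) = indTmul φ 1 (f m) := by
  simp only [indMap, indLift_tmul, one_smul]
  rfl

instance indMod_finite [Module.Finite A M] : Module.Finite B (IndMod φ M) := by
  obtain ⟨s, hs⟩ := (Module.Finite.fg_top : (⊤ : Submodule A M).FG)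
  classical
  refine ⟨⟨s.image (indTmul φ 1), ?_⟩⟩
  rw [eq_top_iff]
  have key : ∀ m : M, indTmul φ 1 m ∈ Submodule.span B (s.image (indTmul φ 1) : Set (IndMod φ M)) := by
    intro m
    have hm : m ∈ Submodule.span A (s : Set M) := hs ▸ Submodule.mem_top
    induction hm using Submodule.span_induction with
    | mem x hx => exact Submodule.subset_span (by simpa using ⟨x, hx, rfl⟩)
    | zero => rw [show indTmul φ 1 (0 : M) = 0 from map_zero (indUnit φ M)]; exact Submodule.zero_mem _
    | add x y _ _ hx hy => rw [indTmul_add]; exact Submodule.add_mem _ hx hy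
    | smul a x _ hx =>
      rw [← indTmul_balanced, one_mul, ← mul_one (φ a), ← smul_indTmul]
      exact Submodule.smul_mem _ _ hx
  rintro x -
  obtain ⟨x, rfl⟩ := (balancedRel φ M).mkQ_surjective x
  induction x using TensorProduct.induction_on with
  | zero => simp
  | add x y hx hy => rw [map_add]; exact Submodule.add_mem _ hx hy
  | tmul b m =>
    have e : (balancedRel φ M).mkQ (b ⊗ₜ[ℤ] m) = b • indTmul φ 1 m := by
      rw [smul_indTmul, mul_one]; rfl
    rw [e]
    exact Submodule.smul_mem _ _ (key m)

instance indMod_projective [Module.Projective A M] : Module.Projective B (IndMod φ M) := by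
  refine Module.Projective.of_lifting_property'' fun f hf => ?_
  let _ : Module A (IndMod φ M →₀ B) := Module.compHom _ φ
  let _ : Module A (IndMod φ M) := Module.compHom _ φ
  let f' : (IndMod φ M →₀ B) →ₗ[A] IndMod φ M :=
    { toFun := f, map_add' := map_add f, map_smul' := fun a x => map_smul f (φ a) x }
  let j : M →ₗ[A] IndMod φ M :=
    { toFun := indTmul φ 1
      map_add' := indTmul_add φ 1
      map_smul' := fun a m => (indUnit φ M).map_smulₛₗ a m }
  obtain ⟨g, hg⟩ := Module.projective_lifting_property f' j hf
  let g' : M →ₛₗ[φ] (IndMod φ M →₀ B) :=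
    { toFun := g, map_add' := map_add g, map_smul' := fun a m => map_smul g a m }
  refine ⟨indLift φ g', ind_hom_ext fun m => ?_⟩
  rw [LinearMap.comp_apply, indLift_tmul, one_smul]
  exact LinearMap.congr_fun hg m

end Lift

/-- The induction functor `K ↦ B ⊗_A K` on finitely generated modules. -/
def ind : FGModuleCat.{u} A ⥤ FGModuleCat.{u} B where
  obj K := FGModuleCat.of B (IndMod φ K)
  map f := FGModuleCat.ofHom (indMap φ f.hom.hom)
  map_id K := by
    apply FGModuleCat.hom_ext
    exact ind_hom_ext fun m => indMap_one_tmul φ _ m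
  map_comp f g := by
    apply FGModuleCat.hom_ext
    refine ind_hom_ext fun m => ?_
    refine (indMap_one_tmul φ _ m).trans ?_
    exact (((congrArg (indMap φ g.hom.hom) (indMap_one_tmul φ f.hom.hom m)).trans
      (indMap_one_tmul φ g.hom.hom _))).symm

end Induction

section Algebras

variable {A B : Type u} [Ring A] [Algebra ℂ A] [Ring B] [Algebra ℂ B] [FiniteDimensional ℂ B]

theorem restrictScalars_isFG (φ : A →ₐ[ℂ] B) (N : FGModuleCat.{u} B) :
    ModuleCat.isFG.{u} A ((ModuleCat.restrictScalars (φ : A →+* B)).obj N.obj) := by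
  let _ : Module ℂ N := Module.compHom N (algebraMap ℂ B)
  have : IsScalarTower ℂ B N := ⟨fun c b x => by
    rw [Algebra.smul_def, mul_smul]; rfl⟩
  have : Module.Finite ℂ N := Module.Finite.trans B N
  let _ : Module A N := Module.compHom N (φ : A →+* B)
  have : IsScalarTower ℂ A N := ⟨fun c a x => by
    change φ (c • a) • x = algebraMap ℂ B c • φ a • x
    rw [map_smul, Algebra.smul_def, mul_smul]⟩
  exact (Module.Finite.of_restrictScalars_finite ℂ A N : Module.Finite A N)

/-- The restriction functor along a homomorphism of finite-dimensional algebras. Over a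
finite-dimensional algebra, "finitely generated" means "finite-dimensional". -/
def res (φ : A →ₐ[ℂ] B) : FGModuleCat.{u} B ⥤ FGModuleCat.{u} A :=
  (ModuleCat.isFG.{u} A).lift
    ((ModuleCat.isFG.{u} B).ι ⋙ ModuleCat.restrictScalars (φ : A →+* B))
    (restrictScalars_isFG φ)

/-- `B` is a Frobenius extension of `A`: restriction is left adjoint to induction on
finite-dimensional modules. (It is always right adjoint to it, so that the two functors are then
biadjoint.) -/
def IsFrobeniusExtension (φ : A →ₐ[ℂ] B) : Prop :=
  Nonempty (res φ ⊣ ind (φ : A →+* B))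

/-- `B` is free as a right `A`-module, with the action `b · a = b φ(a)`. -/
def IsRightFree (φ : A →ₐ[ℂ] B) : Prop :=
  letI : Module Aᵐᵒᵖ B := Module.compHom B (φ : A →+* B).op
  Module.Free Aᵐᵒᵖ B

end Algebras

/-! ## Modules of a finite-dimensional algebra -/

section Modules

variable {A : Type u} [Ring A] [Algebra ℂ A]

/-- The complex dimension of an `A`-module. -/
def dimC (M : FGModuleCat.{u} A) : ℕ :=
  letI : Module ℂ M := Module.compHom M (algebraMap ℂ A)
  Module.finrank ℂ M

/-- `f : P → M` is a projective cover: `P` is projective, `f` is surjective, and no proper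
submodule of `P` maps onto `M` (that is, `ker f` is superfluous). -/
structure IsProjectiveCover {P M : FGModuleCat.{u} A} (f : P →ₗ[A] M) : Prop where
  projective : Module.Projective A P
  surjective : Function.Surjective f
  superfluous : ∀ N : Submodule A P, N ⊔ LinearMap.ker f = ⊤ → N = ⊤

theorem exists_projectiveCover [FiniteDimensional ℂ A] (M : FGModuleCat.{u} A) :
    ∃ (P : FGModuleCat.{u} A) (f : P →ₗ[A] M), IsProjectiveCover f := by
  classical
  let S : ℕ → Prop := fun d => ∃ (P : FGModuleCat.{u} A) (f : P →ₗ[A] M),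
    Module.Projective A P ∧ Function.Surjective f ∧ dimC P = d
  have hS : ∃ d, S d := by
    obtain ⟨n, f, hf⟩ := Module.Finite.exists_fin' A M
    exact ⟨_, FGModuleCat.of A (Fin n → A), f,
      (inferInstance : Module.Projective A (Fin n → A)), hf, rfl⟩
  obtain ⟨P, f, hP, hf, hd⟩ := Nat.find_spec hS
  refine ⟨P, f, hP, hf, fun N hN => ?_⟩
  have hNsurj : Function.Surjective (f ∘ₗ N.subtype) := by
    intro m
    obtain ⟨p, rfl⟩ := hf m
    have hp : p ∈ N ⊔ LinearMap.ker f := hN ▸ Submodule.mem_top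
    obtain ⟨x, hx, y, hy, rfl⟩ := Submodule.mem_sup.1 hp
    refine ⟨⟨x, hx⟩, ?_⟩
    simp [LinearMap.mem_ker.1 hy]
  obtain ⟨g₀, hg₀⟩ := Module.projective_lifting_property (f ∘ₗ N.subtype) f hNsurj
  let g : P →ₗ[A] P := N.subtype ∘ₗ g₀
  have hfg : ∀ x, f (g x) = f x := fun x => LinearMap.congr_fun hg₀ x
  have : IsArtinianRing A := IsArtinianRing.of_finite ℂ A
  obtain ⟨k, hk⟩ := Filter.eventually_atTop.1 (LinearMap.eventually_isCompl_ker_pow_range_pow g)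
  have hc := hk (k + 1) (Nat.le_succ k)
  set h : P →ₗ[A] P := g ^ (k + 1) with hh
  have hfh : ∀ x, f (h x) = f x := by
    intro x
    have : ∀ j : ℕ, f ((g ^ j) x) = f x := by
      intro j
      induction j with
      | zero => rfl
      | succ j ih => rw [pow_succ', Module.End.mul_apply, hfg, ih]
    exact this (k + 1)
  let Q : FGModuleCat.{u} A := FGModuleCat.of A (LinearMap.range h)
  have hQ : Module.Projective A (LinearMap.range h) := by
    refine Module.Projective.of_split (LinearMap.range h).subtype
      (Submodule.projectionOnto _ _ hc.symm) ?_
    exact LinearMap.ext fun x => Submodule.projectionOnto_apply_left hc.symm x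
  have hSQ : S (dimC Q) := by
    refine ⟨Q, f ∘ₗ (LinearMap.range h).subtype, hQ, fun m => ?_, rfl⟩
    obtain ⟨p, rfl⟩ := hf m
    exact ⟨⟨h p, p, rfl⟩, hfh p⟩
  have hmin : dimC P ≤ dimC Q := hd ▸ Nat.find_min' hS hSQ
  have htop : LinearMap.range h = ⊤ := by
    let _ : Module ℂ P := Module.compHom P (algebraMap ℂ A)
    have : IsScalarTower ℂ A P := ⟨fun c b x => by
      rw [Algebra.smul_def, mul_smul]; rfl⟩
    have : Module.Finite ℂ P := Module.Finite.trans A P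
    have : (LinearMap.range h).restrictScalars ℂ = ⊤ :=
      Submodule.eq_top_of_finrank_eq (le_antisymm (Submodule.finrank_le _) hmin)
    simpa using this
  rw [eq_top_iff, ← htop]
  rintro _ ⟨x, rfl⟩
  rw [hh, pow_succ', Module.End.mul_apply]
  exact (g₀ _).2

variable (A)

/-- Two simple modules are equivalent when they are isomorphic. -/
def simpleSetoid : Setoid {M : FGModuleCat.{u} A // IsSimpleModule A M} where
  r M N := Nonempty (M.1 ≃ₗ[A] N.1)
  iseqv :=
    { refl := fun M => ⟨LinearEquiv.refl A M.1⟩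
      symm := fun ⟨e⟩ => ⟨e.symm⟩
      trans := fun ⟨e⟩ ⟨e'⟩ => ⟨e.trans e'⟩ }

/-- The set of isomorphism classes of simple `A`-modules. -/
def SimpleClass : Type (u + 1) := Quotient (simpleSetoid A)

variable {A}

/-- The simple module `L^μ` in the class `μ`. -/
def simpleMod (μ : SimpleClass A) : FGModuleCat.{u} A := (Quotient.out μ).1

/-- The projective cover `P^μ` of `L^μ`. -/
def projMod [FiniteDimensional ℂ A] (μ : SimpleClass A) : FGModuleCat.{u} A :=
  (exists_projectiveCover (simpleMod μ)).choose

theorem projMod_projective [FiniteDimensional ℂ A] (μ : SimpleClass A) :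
    Module.Projective A (projMod μ) :=
  (exists_projectiveCover (simpleMod μ)).choose_spec.choose_spec.projective

variable (A)

/-- The relations `[M] + [N] = [K]` for short exact sequences `0 → M → K → N → 0`. -/
def gRel : AddSubgroup (FreeAbelianGroup (FGModuleCat.{u} A)) :=
  AddSubgroup.closure
    {x | ∃ (M K N : FGModuleCat.{u} A) (f : M →ₗ[A] K) (g : K →ₗ[A] N),
      Function.Injective f ∧ Function.Exact f g ∧ Function.Surjective g ∧
      x = FreeAbelianGroup.of M + FreeAbelianGroup.of N - FreeAbelianGroup.of K}

/-- The Grothendieck group `G_0` of finite-dimensional modules. -/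
abbrev G0 : Type (u + 1) := FreeAbelianGroup (FGModuleCat.{u} A) ⧸ gRel A

/-- The relations `[P] + [P'] = [P'']` for `P ⊕ P' ≅ P''`. -/
def kRel : AddSubgroup
    (FreeAbelianGroup {P : FGModuleCat.{u} A // Module.Projective A P}) :=
  AddSubgroup.closure
    {x | ∃ P P' P'' : {P : FGModuleCat.{u} A // Module.Projective A P},
      Nonempty ((P.1 × P'.1) ≃ₗ[A] P''.1) ∧
      x = FreeAbelianGroup.of P + FreeAbelianGroup.of P' - FreeAbelianGroup.of P''}

/-- The split Grothendieck group `K_0` of finite-dimensional projective modules. -/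
abbrev K0 : Type (u + 1) :=
  FreeAbelianGroup {P : FGModuleCat.{u} A // Module.Projective A P} ⧸ kRel A

variable {A}

/-- The class `[M]` in `G_0`. -/
def gClass (M : FGModuleCat.{u} A) : G0 A := QuotientAddGroup.mk (FreeAbelianGroup.of M)

/-- The class `[P]` in `K_0`. -/
def kClass (P : FGModuleCat.{u} A) (hP : Module.Projective A P) : K0 A :=
  QuotientAddGroup.mk (FreeAbelianGroup.of ⟨P, hP⟩)

open Classical in
/-- The coordinates of `x` with respect to a family `v` in an abelian group: the unique finitely
supported integers `c` with `∑ i, c i • v i = x`, and `0` if there is no unique such `c`. -/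
def coords {ι G : Type*} [AddCommGroup G] (v : ι → G) (x : G) : ι →₀ ℤ :=
  if h : ∃! c : ι →₀ ℤ, (c.sum fun i k => k • v i) = x then h.choose else 0

end Modules

/-! ## Towers of algebras -/

/-- A tower `A_0 ⊂ A_1 ⊂ A_2 ⊂ ⋯` of finite-dimensional complex algebras with `A_0 = ℂ`. -/
structure Tower where
  A : ℕ → Type u
  [ring : ∀ n, Ring (A n)]
  [algebra : ∀ n, Algebra ℂ (A n)]
  [finite : ∀ n, FiniteDimensional ℂ (A n)]
  incl : ∀ n, A n →ₐ[ℂ] A (n + 1)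
  incl_injective : ∀ n, Function.Injective (incl n)
  zero_eq : Function.Bijective (algebraMap ℂ (A 0))

attribute [instance] Tower.ring Tower.algebra Tower.finite

namespace Tower

variable (T : Tower.{u})

/-- Each `A_{n+1}` is a free Frobenius extension of `A_n`. -/
def IsFreeFrobenius : Prop :=
  ∀ n, IsFrobeniusExtension (T.incl n) ∧ IsRightFree (T.incl n)

/-- The induction functor from `A_n`-modules to `A_{n+1}`-modules. -/
abbrev indStep (n : ℕ) : FGModuleCat.{u} (T.A n) ⥤ FGModuleCat.{u} (T.A (n + 1)) :=
  ind (T.incl n : T.A n →+* T.A (n + 1))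

/-- `Γ`, the disjoint union of the sets `Γ_n` of isomorphism classes of simple `A_n`-modules. -/
abbrev Gam : Type (u + 1) := Σ n, SimpleClass (T.A n)

/-- `dim L^μ`. -/
def dimL (μ : T.Gam) : ℕ := dimC (simpleMod μ.2)

/-- `dim P^μ`. -/
def dimP (μ : T.Gam) : ℕ := dimC (projMod μ.2)

theorem ind_projMod_projective {n : ℕ} (μ : SimpleClass (T.A n)) :
    Module.Projective (T.A (n + 1)) ((T.indStep n).obj (projMod μ)) :=
  have := projMod_projective μ
  indMod_projective (M := projMod μ) (T.incl n : T.A n →+* T.A (n + 1))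

/-- The coefficients of `[Ind P^μ] = ∑_λ κ(μ, λ) [P^λ]` in `K_0` of `A_{n+1}`. -/
def kappaStep {n : ℕ} (μ : SimpleClass (T.A n)) : SimpleClass (T.A (n + 1)) →₀ ℤ :=
  coords (fun l => kClass (projMod l) (projMod_projective l))
    (kClass ((T.indStep n).obj (projMod μ)) (T.ind_projMod_projective μ))

/-- The coefficients of `[Ind L^μ] = ∑_λ κ^*(μ, λ) [L^λ]` in `G_0` of `A_{n+1}`. -/
def kappaStarStep {n : ℕ} (μ : SimpleClass (T.A n)) : SimpleClass (T.A (n + 1)) →₀ ℤ :=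
  coords (fun l => gClass (simpleMod l)) (gClass ((T.indStep n).obj (simpleMod μ)))

/-- `κ`, extended by zero to `Γ × Γ`. -/
def kappa (μ l : T.Gam) : ℤ :=
  if h : l.1 = μ.1 + 1 then T.kappaStep μ.2 (h ▸ l.2) else 0

/-- `κ^*`, extended by zero to `Γ × Γ`. -/
def kappaStar (μ l : T.Gam) : ℤ :=
  if h : l.1 = μ.1 + 1 then T.kappaStarStep μ.2 (h ▸ l.2) else 0

end Tower

/-! ## Graded graphs and coherent measures -/

/-- A graded graph: a vertex set, a rank function, and a multiset of edges (`mult x y` is the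
multiplicity of the edge `(x, y)`) that raise the rank by one. -/
structure GradedGraph where
  V : Type*
  rank : V → ℤ
  mult : V → V → ℕ
  rank_eq : ∀ x y, mult x y ≠ 0 → rank y = rank x + 1

namespace GradedGraph

/-- The `n`-th graded component. -/
abbrev comp (G : GradedGraph) (n : ℤ) : Type _ := {v : G.V // G.rank v = n}

/-- Down transition functions. -/
structure IsDownTransition (G : GradedGraph) (p : G.V → G.V → ℝ) : Prop where
  mem_Icc : ∀ x y, p x y ∈ Set.Icc (0 : ℝ) 1
  pos_iff : ∀ x y, 0 < p x y ↔
    ∃ n : ℤ, G.rank x = n + 1 ∧ G.rank y = n ∧ G.mult y x ≠ 0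
  sum_eq_one : ∀ (n : ℕ) (x : G.V), G.rank x = n + 1 →
    HasSum (fun y : G.comp n => p x y) 1

/-- `M` gives the weights of a probability measure on a discrete set. -/
structure IsProbability {X : Type*} (M : X → ℝ) : Prop where
  nonneg : ∀ x, 0 ≤ M x
  hasSum_one : HasSum M 1

/-- The `M n`, `n ≥ 0`, are (everywhere positive) probability measures on the graded components
of `G`, coherent with respect to the down transition function `p`. -/
structure IsCoherent (G : GradedGraph) (p : G.V → G.V → ℝ) (M : ∀ n : ℕ, G.comp n → ℝ) :
    Prop where
  isDownTransition : G.IsDownTransition p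
  isProbability : ∀ n, IsProbability (M n)
  pos : ∀ n x, 0 < M n x
  coherent : ∀ (n : ℕ) (x : G.comp n),
    HasSum (fun y : G.comp ((n + 1 : ℕ) : ℤ) => M (n + 1) y * p y x) (M n x)

end GradedGraph

namespace Tower

variable (T : Tower.{u})

/-- The graph `G_Γ`: there is an edge from `μ ∈ Γ_n` to `l ∈ Γ_{n+1}` when `κ(μ, l) > 0`. -/
def graph : GradedGraph where
  V := T.Gam
  rank μ := μ.1
  mult μ l := if 0 < T.kappa μ l then 1 else 0
  rank_eq μ l h := by
    by_contra hne
    have h' : ¬ l.1 = μ.1 + 1 := fun e => hne (by rw [e]; push_cast; rfl)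
    simp [kappa, h'] at h

/-- The graph `G_Γ^*`: there is an edge from `μ ∈ Γ_n` to `l ∈ Γ_{n+1}` when `κ^*(μ, l) > 0`. -/
def graphStar : GradedGraph where
  V := T.Gam
  rank μ := μ.1
  mult μ l := if 0 < T.kappaStar μ l then 1 else 0
  rank_eq μ l h := by
    by_contra hne
    have h' : ¬ l.1 = μ.1 + 1 := fun e => hne (by rw [e]; push_cast; rfl)
    simp [kappaStar, h'] at h

/-- The non-semisimple Plancherel weight `Pl_n(μ) = dim L^μ dim P^μ / dim A_n` of `μ ∈ Γ_n`. -/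
def Pl (μ : T.Gam) : ℝ :=
  (T.dimL μ : ℝ) * (T.dimP μ : ℝ) / (Module.finrank ℂ (T.A μ.1) : ℝ)

/-- `p_↓(μ, η) = κ(η, μ) dim L^η / dim L^μ`. -/
def pDown (μ η : T.Gam) : ℝ :=
  (T.kappa η μ : ℝ) * (T.dimL η : ℝ) / (T.dimL μ : ℝ)

/-- `p_↓^*(μ, η) = κ^*(η, μ) dim P^η / dim P^μ`. -/
def pDownStar (μ η : T.Gam) : ℝ :=
  (T.kappaStar η μ : ℝ) * (T.dimP η : ℝ) / (T.dimP μ : ℝ)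

end Tower

end FrobTower

end

/-!
For finite-dimensional modules over a finite-dimensional complex algebra, `dim Hom(P^μ, L^l)` is
`1` or `0` according to whether `μ = l` (`homDim_projMod_simpleMod`: a superfluous kernel forces
every map `P^μ → L^l` to factor through `L^μ`, and Schur's lemma applies). Since the functions
`dim Hom(P^l, -)` and `dim Hom(-, L^l)` descend to `G_0` and `K_0`, the classes `[L^l]` and
`[P^l]` are bases of these groups, with the two families of functions as dual coordinates
(`coords_gClass`, `coords_kClass`). Taking dimensions gives
`dim M = ∑ dim Hom(P^l, M) dim L^l` for all `M` and `dim P = ∑ dim Hom(P, L^l) dim P^l` for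
projective `P`; the second formula for `P = A` reads `dim A = ∑ dim L^l dim P^l`, so that `Pl_n`
has total mass one.

The branching coefficients are therefore dimensions of spaces of homomorphisms. By Frobenius
reciprocity `κ(μ, l) = dim Hom(P^μ, Res L^l)`, so the dimension formula for `Res L^l` says that
`p_↓` sums to one. By the adjunction `Res ⊣ Ind`, `κ^*(μ, l) = dim Hom(Res P^l, L^μ)`; moreover
`Res P^l` is projective, because the right adjoint `Ind` preserves surjections
(`res_projective`), so its dimension formula says that `p^*_↓` sums to one. Coherence is the
dimension formula for `Ind P^μ`, respectively `Ind L^μ`, together with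
`dim A_n · dim Ind M = dim A_{n+1} · dim M`, which holds because `A_{n+1}` is a free right
`A_n`-module (`finrank_mul_dimC_ind`).
-/

noncomputable section

namespace FrobTower

/-! ### Dimensions of modules and of spaces of homomorphisms -/

section Dimension

variable {A : Type u} [Ring A] [Algebra ℂ A]

/-- The complex vector space underlying an `A`-module, with the scalar action that `dimC` uses. -/
instance complexModule (M : FGModuleCat.{u} A) : Module ℂ M := Module.compHom M (algebraMap ℂ A)

instance complexModule_isScalarTower (M : FGModuleCat.{u} A) : IsScalarTower ℂ A M :=
  ⟨fun c b x => by rw [Algebra.smul_def, mul_smul]; rfl⟩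

instance complexModule_finite [FiniteDimensional ℂ A] (M : FGModuleCat.{u} A) :
    FiniteDimensional ℂ M :=
  Module.Finite.trans A M

theorem complexModule_smul_def (M : FGModuleCat.{u} A) (c : ℂ) (m : M) :
    c • m = algebraMap ℂ A c • m := rfl

theorem dimC_of (N : Type u) [AddCommGroup N] [Module A N] [Module.Finite A N] [Module ℂ N]
    [IsScalarTower ℂ A N] : dimC (FGModuleCat.of A N) = Module.finrank ℂ N := by
  refine congrArg (fun i => @Module.finrank ℂ N _ _ i) (Module.ext' _ _ fun c x => ?_)
  exact algebraMap_smul A c x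

/-- The complex dimension of `Hom_A(M, N)`. -/
def homDim (M N : FGModuleCat.{u} A) : ℕ := Module.finrank ℂ (M →ₗ[A] N)

theorem homDim_of (M : FGModuleCat.{u} A) (N : Type u) [AddCommGroup N] [Module A N]
    [Module.Finite A N] [Module ℂ N] [IsScalarTower ℂ A N] :
    homDim M (FGModuleCat.of A N) = Module.finrank ℂ (M →ₗ[A] N) := by
  refine congrArg (fun i => @Module.finrank ℂ (M →ₗ[A] N) _ _ i) (Module.ext' _ _ fun c f => ?_)
  exact LinearMap.ext fun x => algebraMap_smul A c (f x)

theorem finrank_eq_add_of_exact {V W X : Type*} [AddCommGroup V] [Module ℂ V] [AddCommGroup W]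
    [Module ℂ W] [AddCommGroup X] [Module ℂ X] [FiniteDimensional ℂ W]
    {f : V →ₗ[ℂ] W} {g : W →ₗ[ℂ] X} (hf : Function.Injective f) (hfg : Function.Exact f g)
    (hg : Function.Surjective g) :
    Module.finrank ℂ W = Module.finrank ℂ V + Module.finrank ℂ X := by
  rw [← LinearMap.finrank_range_add_finrank_ker g, LinearMap.range_eq_top.2 hg, finrank_top,
    LinearMap.exact_iff.1 hfg, LinearMap.finrank_range_of_inj hf, add_comm]

theorem homDim_congr_left {M M' : FGModuleCat.{u} A} (e : M ≃ₗ[A] M') (N : FGModuleCat.{u} A) :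
    homDim M N = homDim M' N :=
  LinearEquiv.finrank_eq
    { LinearMap.lcomp ℂ N (e.symm : M' →ₗ[A] M) with
      invFun := LinearMap.lcomp ℂ N (e : M →ₗ[A] M')
      left_inv := fun f => by ext; simp
      right_inv := fun f => by ext; simp }

theorem homDim_self (M : FGModuleCat.{u} A) : homDim (FGModuleCat.of A A) M = dimC M :=
  (LinearMap.ringLmapEquivSelf A ℂ M).finrank_eq

variable [FiniteDimensional ℂ A]

instance hom_finite (M N : FGModuleCat.{u} A) : FiniteDimensional ℂ (M →ₗ[A] N) :=
  Module.Finite.of_injective (LinearMap.restrictScalarsₗ ℂ A M N ℂ)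
    (LinearMap.restrictScalars_injective ℂ)

theorem dimC_eq_add_of_exact {M K N : FGModuleCat.{u} A} {f : M →ₗ[A] K} {g : K →ₗ[A] N}
    (hf : Function.Injective f) (hfg : Function.Exact f g) (hg : Function.Surjective g) :
    dimC K = dimC M + dimC N :=
  finrank_eq_add_of_exact (f := f.restrictScalars ℂ) (g := g.restrictScalars ℂ) hf hfg hg

theorem homDim_eq_add_of_exact {P M K N : FGModuleCat.{u} A} [Module.Projective A P]
    {f : M →ₗ[A] K} {g : K →ₗ[A] N}
    (hf : Function.Injective f) (hfg : Function.Exact f g) (hg : Function.Surjective g) :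
    homDim P K = homDim P M + homDim P N := by
  refine finrank_eq_add_of_exact (f := LinearMap.compRight ℂ f) (g := LinearMap.compRight ℂ g)
    ?_ ?_ ?_
  · intro a b h
    exact LinearMap.ext fun x => hf (LinearMap.congr_fun h x)
  · intro k
    constructor
    · intro h
      have hk : ∀ x, k x ∈ LinearMap.range f := fun x =>
        (hfg (k x)).1 (LinearMap.congr_fun h x)
      let e := LinearEquiv.ofInjective f hf
      refine ⟨e.symm.toLinearMap ∘ₗ k.codRestrict _ hk, LinearMap.ext fun x => ?_⟩
      change f (e.symm (k.codRestrict _ hk x)) = k x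
      exact congrArg Subtype.val (e.apply_symm_apply (k.codRestrict _ hk x))
    · rintro ⟨a, rfl⟩
      exact LinearMap.ext fun x => (hfg _).2 ⟨a x, rfl⟩
  · intro k
    obtain ⟨a, ha⟩ := Module.projective_lifting_property g k hg
    exact ⟨a, ha⟩

theorem homDim_eq_add_of_prod {P P' P'' : FGModuleCat.{u} A} (e : (P × P') ≃ₗ[A] P'')
    (N : FGModuleCat.{u} A) : homDim P'' N = homDim P N + homDim P' N := by
  have h := homDim_congr_left (M := FGModuleCat.of A (P × P')) e N
  rw [← h]
  have : homDim (FGModuleCat.of A (P × P')) N =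
      Module.finrank ℂ ((P →ₗ[A] N) × (P' →ₗ[A] N)) :=
    (LinearMap.coprodEquiv (R := A) ℂ).finrank_eq.symm
  rw [this, Module.finrank_prod]
  rfl

theorem dimC_eq_add_of_prod {P P' P'' : FGModuleCat.{u} A} (e : (P × P') ≃ₗ[A] P'') :
    dimC P'' = dimC P + dimC P' := by
  refine dimC_eq_add_of_exact (f := e.toLinearMap ∘ₗ LinearMap.inl A P P')
    (g := LinearMap.snd A P P' ∘ₗ e.symm.toLinearMap) ?_ ?_ ?_
  · exact e.injective.comp LinearMap.inl_injective
  · intro x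
    obtain ⟨⟨a, b⟩, rfl⟩ := e.surjective x
    simp [eq_comm]
  · exact (LinearMap.snd_surjective (R := A) (M := P) (M₂ := P')).comp e.symm.surjective

theorem dimC_pos (M : FGModuleCat.{u} A) [Nontrivial M] : 0 < dimC M :=
  Module.finrank_pos (R := ℂ) (M := M)

end Dimension

/-! ### Simple modules and their projective covers -/

section Simple

variable {A : Type u} [Ring A]

instance simpleMod_isSimple (μ : SimpleClass A) : IsSimpleModule A (simpleMod μ) :=
  (Quotient.out μ).2

theorem simpleMod_mk (S : FGModuleCat.{u} A) (hS : IsSimpleModule A S) :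
    Nonempty (S ≃ₗ[A] simpleMod (Quotient.mk (simpleSetoid A) ⟨S, hS⟩)) :=
  have ⟨e⟩ := Quotient.mk_out (s := simpleSetoid A) ⟨S, hS⟩
  ⟨e.symm⟩

theorem eq_of_simpleMod_equiv {μ l : SimpleClass A} (e : simpleMod μ ≃ₗ[A] simpleMod l) :
    μ = l := by
  rw [← Quotient.out_eq μ, ← Quotient.out_eq l]
  exact Quotient.sound ⟨e⟩

theorem exists_surjective_simpleMod (M : FGModuleCat.{u} A) [Nontrivial M] :
    ∃ (μ : SimpleClass A) (f : M →ₗ[A] simpleMod μ), Function.Surjective f := by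
  obtain ⟨N, hN⟩ : ∃ N : Submodule A M, IsCoatom N :=
    IsCoatomic.exists_coatom (Submodule A M)
  have hS : IsSimpleModule A (M ⧸ N) := isSimpleModule_iff_isCoatom.2 hN
  obtain ⟨e⟩ := simpleMod_mk (FGModuleCat.of A (M ⧸ N)) hS
  exact ⟨_, e.toLinearMap ∘ₗ N.mkQ, e.surjective.comp N.mkQ_surjective⟩

variable [Algebra ℂ A] [FiniteDimensional ℂ A]

instance (μ : SimpleClass A) : Module.Projective A (projMod μ) := projMod_projective μ

/-- The covering map `P^μ → L^μ`. -/
def projCover (μ : SimpleClass A) : projMod μ →ₗ[A] simpleMod μ :=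
  (exists_projectiveCover (simpleMod μ)).choose_spec.choose

theorem projCover_isProjectiveCover (μ : SimpleClass A) : IsProjectiveCover (projCover μ) :=
  (exists_projectiveCover (simpleMod μ)).choose_spec.choose_spec

instance (μ : SimpleClass A) : Nontrivial (projMod μ) :=
  have := IsSimpleModule.nontrivial A (simpleMod μ)
  (projCover_isProjectiveCover μ).surjective.nontrivial

theorem dimC_simpleMod_pos (μ : SimpleClass A) : 0 < dimC (simpleMod μ) :=
  have := IsSimpleModule.nontrivial A (simpleMod μ)
  dimC_pos _

/-- The kernel of the cover is the unique maximal submodule of `P^μ`: a second one would span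
`P^μ` together with it, against superfluousness. Hence every map to a simple module factors through
the cover. -/
theorem ker_projCover_le_ker {μ l : SimpleClass A} (f : projMod μ →ₗ[A] simpleMod l) :
    LinearMap.ker (projCover μ) ≤ LinearMap.ker f := by
  by_cases hf : f = 0
  · simp [hf]
  have hc : IsCoatom (LinearMap.ker f) :=
    LinearMap.isCoatom_ker_of_surjective (LinearMap.surjective_of_ne_zero hf)
  by_contra hle
  have htop : LinearMap.ker f ⊔ LinearMap.ker (projCover μ) = ⊤ :=
    hc.2 _ (left_lt_sup.2 hle)
  exact hc.1 ((projCover_isProjectiveCover μ).superfluous _ htop)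

theorem homDim_projMod_simpleMod_eq (μ l : SimpleClass A) :
    homDim (projMod μ) (simpleMod l) = Module.finrank ℂ (simpleMod μ →ₗ[A] simpleMod l) := by
  refine (LinearEquiv.finrank_eq (LinearEquiv.ofBijective
    (LinearMap.lcomp ℂ (simpleMod l) (projCover μ)) ⟨?_, ?_⟩)).symm
  · intro a b h
    refine LinearMap.ext fun x => ?_
    obtain ⟨y, rfl⟩ := (projCover_isProjectiveCover μ).surjective x
    exact LinearMap.congr_fun h y
  · intro f
    let e := (projCover μ).quotKerEquivOfSurjective (projCover_isProjectiveCover μ).surjective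
    refine ⟨(LinearMap.ker (projCover μ)).liftQ f (ker_projCover_le_ker f) ∘ₗ e.symm.toLinearMap,
      LinearMap.ext fun x => ?_⟩
    have hx : e.symm (projCover μ x) = Submodule.Quotient.mk x := by
      rw [LinearEquiv.symm_apply_eq]
      rfl
    change Submodule.liftQ _ f (ker_projCover_le_ker f) (e.symm (projCover μ x)) = f x
    rw [hx, Submodule.liftQ_apply]

open Classical in
/-- Projective covers and simple modules are dual to each other under `dim Hom`. -/
theorem homDim_projMod_simpleMod (μ l : SimpleClass A) :
    homDim (projMod μ) (simpleMod l) = if μ = l then 1 else 0 := by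
  rw [homDim_projMod_simpleMod_eq]
  split_ifs with h
  · subst h
    have hb := IsSimpleModule.algebraMap_end_bijective_of_isAlgClosed (A := A)
      (V := simpleMod μ) ℂ
    rw [← (LinearEquiv.ofBijective (Algebra.linearMap ℂ (Module.End A (simpleMod μ)))
      hb).finrank_eq, Module.finrank_self]
  · rw [Module.finrank_eq_zero_iff_of_free, ← not_nontrivial_iff_subsingleton]
    rintro ⟨f, g, hfg⟩
    have : ∃ f : simpleMod μ →ₗ[A] simpleMod l, f ≠ 0 := by
      by_cases hf : f = 0
      · exact ⟨g, fun hg => hfg (hf.trans hg.symm)⟩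
      · exact ⟨f, hf⟩
    obtain ⟨f, hf⟩ := this
    exact h (eq_of_simpleMod_equiv
      (LinearEquiv.ofBijective f (LinearMap.bijective_of_ne_zero hf)))

end Simple

/-! ### Bases of the Grothendieck groups -/

section Coords

variable {ι G : Type*} [AddCommGroup G] {v : ι → G}

open Classical in
/-- If a family in an abelian group has dual functionals, every element of its span has
well-defined coordinates, and the functionals compute them. -/
theorem coords_spec (θ : ι → G →+ ℤ) (hθ : ∀ i j, θ i (v j) = if i = j then 1 else 0) {x : G}
    (hx : x ∈ Submodule.span ℤ (Set.range v)) :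
    ((coords v x).sum fun i k => k • v i) = x ∧ ∀ i, coords v x i = θ i x := by
  have key : ∀ c : ι →₀ ℤ, (c.sum fun i k => k • v i) = x → ∀ i, c i = θ i x := by
    rintro c rfl i
    rw [Finsupp.sum, map_sum]
    simp [hθ, eq_comm]
  obtain ⟨c, hc⟩ := Finsupp.mem_span_range_iff_exists_finsupp.1 hx
  have hu : ∃! c : ι →₀ ℤ, (c.sum fun i k => k • v i) = x :=
    ⟨c, hc, fun d hd => Finsupp.ext fun i => (key d hd i).trans (key c hc i).symm⟩
  have h : coords v x = hu.choose := dif_pos hu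
  rw [h]
  exact ⟨hu.choose_spec.1, key _ hu.choose_spec.1⟩

end Coords

section Grothendieck

variable {A : Type u} [Ring A]

theorem gClass_eq_add {M K N : FGModuleCat.{u} A} {f : M →ₗ[A] K} {g : K →ₗ[A] N}
    (hf : Function.Injective f) (hfg : Function.Exact f g) (hg : Function.Surjective g) :
    gClass K = gClass M + gClass N := by
  refine Eq.symm (sub_eq_zero.1 ?_)
  exact (QuotientAddGroup.eq_zero_iff _).2
    (AddSubgroup.subset_closure ⟨M, K, N, f, g, hf, hfg, hg, rfl⟩)

theorem kClass_eq_add {P P' P'' : FGModuleCat.{u} A} (hP : Module.Projective A P)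
    (hP' : Module.Projective A P') (hP'' : Module.Projective A P'') (e : (P × P') ≃ₗ[A] P'') :
    kClass P'' hP'' = kClass P hP + kClass P' hP' := by
  refine Eq.symm (sub_eq_zero.1 ?_)
  exact (QuotientAddGroup.eq_zero_iff _).2
    (AddSubgroup.subset_closure ⟨⟨P, hP⟩, ⟨P', hP'⟩, ⟨P'', hP''⟩, ⟨e⟩, rfl⟩)

/-- The homomorphism out of `G_0` given by a function that is additive on short exact sequences. -/
def gLift (d : FGModuleCat.{u} A → ℕ)
    (hd : ∀ (M K N : FGModuleCat.{u} A) (f : M →ₗ[A] K) (g : K →ₗ[A] N),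
      Function.Injective f → Function.Exact f g → Function.Surjective g → d K = d M + d N) :
    G0 A →+ ℤ :=
  QuotientAddGroup.lift (gRel A) (FreeAbelianGroup.lift fun M => (d M : ℤ)) (by
    rw [gRel, AddSubgroup.closure_le]
    rintro _ ⟨M, K, N, f, g, hf, hfg, hg, rfl⟩
    rw [SetLike.mem_coe, AddMonoidHom.mem_ker]
    simp [hd M K N f g hf hfg hg])

@[simp]
theorem gLift_gClass (d : FGModuleCat.{u} A → ℕ) (hd) (M : FGModuleCat.{u} A) :
    gLift d hd (gClass M) = d M := by
  change FreeAbelianGroup.lift (fun M => (d M : ℤ)) (FreeAbelianGroup.of M) = _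
  rw [FreeAbelianGroup.lift_apply_of]

/-- The homomorphism out of `K_0` given by a function that is additive on direct sums. -/
def kLift (d : FGModuleCat.{u} A → ℕ)
    (hd : ∀ (P P' P'' : FGModuleCat.{u} A), ((P × P') ≃ₗ[A] P'') → d P'' = d P + d P') :
    K0 A →+ ℤ :=
  QuotientAddGroup.lift (kRel A) (FreeAbelianGroup.lift fun P => (d P.1 : ℤ)) (by
    rw [kRel, AddSubgroup.closure_le]
    rintro _ ⟨P, P', P'', ⟨e⟩, rfl⟩
    rw [SetLike.mem_coe, AddMonoidHom.mem_ker]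
    simp [hd _ _ _ e])

@[simp]
theorem kLift_kClass (d : FGModuleCat.{u} A → ℕ) (hd) (P : FGModuleCat.{u} A)
    (hP : Module.Projective A P) : kLift d hd (kClass P hP) = d P := by
  change FreeAbelianGroup.lift (fun P : {P : FGModuleCat.{u} A // Module.Projective A P} =>
    (d P.1 : ℤ)) (FreeAbelianGroup.of ⟨P, hP⟩) = _
  rw [FreeAbelianGroup.lift_apply_of]

variable [Algebra ℂ A] [FiniteDimensional ℂ A]

/-- The classes of the simple modules span `G_0`: split off a simple quotient and use induction on
the dimension. -/
theorem gClass_mem_span (M : FGModuleCat.{u} A) :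
    gClass M ∈ Submodule.span ℤ (Set.range fun l : SimpleClass A => gClass (simpleMod l)) := by
  induction h : dimC M using Nat.strong_induction_on generalizing M with
  | _ d ih =>
  subst h
  rcases subsingleton_or_nontrivial M with hM | hM
  · have h0 : gClass M = gClass M + gClass M :=
      gClass_eq_add (f := LinearMap.id) (g := (0 : M →ₗ[A] M)) Function.injective_id
        (fun x => ⟨fun _ => ⟨x, rfl⟩, fun _ => rfl⟩) (fun x => ⟨0, Subsingleton.elim _ _⟩)
    rw [left_eq_add.1 h0]
    exact Submodule.zero_mem _
  · obtain ⟨μ, f, hf⟩ := exists_surjective_simpleMod M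
    have : IsNoetherianRing A := IsNoetherianRing.of_finite ℂ A
    let K : FGModuleCat.{u} A := FGModuleCat.of A (LinearMap.ker f)
    have hi : Function.Injective (LinearMap.ker f).subtype := Subtype.val_injective
    have he : Function.Exact (LinearMap.ker f).subtype f := LinearMap.exact_subtype_ker_map f
    have hdim := dimC_eq_add_of_exact (M := K) hi he hf
    rw [gClass_eq_add (M := K) hi he hf]
    refine Submodule.add_mem _ (ih _ ?_ K rfl) (Submodule.subset_span ⟨μ, rfl⟩)
    have := dimC_simpleMod_pos μ
    omega

/-- A nonzero projective module has an indecomposable projective `P^μ` as a direct summand. -/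
theorem exists_projMod_prod_equiv (P : FGModuleCat.{u} A) [Module.Projective A P] [Nontrivial P] :
    ∃ (μ : SimpleClass A) (Q : FGModuleCat.{u} A), Module.Projective A Q ∧
      Nonempty ((Q × projMod μ) ≃ₗ[A] P) := by
  have : IsNoetherianRing A := IsNoetherianRing.of_finite ℂ A
  obtain ⟨μ, f, hf⟩ := exists_surjective_simpleMod P
  have hc := projCover_isProjectiveCover μ
  obtain ⟨g, hg⟩ := Module.projective_lifting_property (projCover μ) f hc.surjective
  have hgs : Function.Surjective g := by
    refine LinearMap.range_eq_top.1 (hc.superfluous _ (eq_top_iff.2 fun y _ => ?_))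
    obtain ⟨x, hx⟩ := hf (projCover μ y)
    have hgx : projCover μ (g x) = projCover μ y := (LinearMap.congr_fun hg x).trans hx
    refine Submodule.mem_sup.2 ⟨g x, ⟨x, rfl⟩, y - g x, ?_, by abel⟩
    rw [LinearMap.mem_ker, map_sub, hgx, sub_self]
  obtain ⟨s, hs⟩ := Module.projective_lifting_property g LinearMap.id hgs
  have he : Function.Exact (LinearMap.ker g).subtype g := LinearMap.exact_subtype_ker_map g
  let e := (he.splitSurjectiveEquiv Subtype.val_injective ⟨s, hs⟩).1
  refine ⟨μ, FGModuleCat.of A (LinearMap.ker g), ?_, ⟨e.symm⟩⟩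
  refine Module.Projective.of_split
    (e.symm.toLinearMap ∘ₗ LinearMap.inl A (LinearMap.ker g) (projMod μ))
    (LinearMap.fst A (LinearMap.ker g) (projMod μ) ∘ₗ e.toLinearMap) ?_
  ext x
  simp

/-- The classes of the `P^μ` span `K_0`: split off an indecomposable summand and use induction on
the dimension. -/
theorem kClass_mem_span (P : FGModuleCat.{u} A) (hP : Module.Projective A P) :
    kClass P hP ∈ Submodule.span ℤ
      (Set.range fun l : SimpleClass A => kClass (projMod l) (projMod_projective l)) := by
  induction h : dimC P using Nat.strong_induction_on generalizing P with
  | _ d ih =>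
  subst h
  rcases subsingleton_or_nontrivial P with hM | hM
  · have h0 : kClass P hP = kClass P hP + kClass P hP :=
      kClass_eq_add hP hP hP ⟨LinearMap.fst A P P, fun x => (x, 0),
        fun x => Prod.ext rfl (Subsingleton.elim _ _), fun x => rfl⟩
    rw [left_eq_add.1 h0]
    exact Submodule.zero_mem _
  · obtain ⟨μ, Q, hQ, ⟨e⟩⟩ := exists_projMod_prod_equiv P
    have hdim := dimC_eq_add_of_prod e
    rw [kClass_eq_add hQ (projMod_projective μ) hP e]
    refine Submodule.add_mem _ (ih _ ?_ Q hQ rfl) (Submodule.subset_span ⟨μ, rfl⟩)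
    have := dimC_pos (projMod μ)
    omega

theorem coords_gClass (M : FGModuleCat.{u} A) :
    (((coords (fun l : SimpleClass A => gClass (simpleMod l)) (gClass M)).sum
      fun l k => k • gClass (simpleMod l)) = gClass M) ∧
    ∀ l, coords (fun l : SimpleClass A => gClass (simpleMod l)) (gClass M) l =
      homDim (projMod l) M := by
  classical
  have h := coords_spec
    (fun l => gLift (homDim (projMod l)) fun _ _ _ _ _ => homDim_eq_add_of_exact)
    (fun i j => by simp [homDim_projMod_simpleMod]) (gClass_mem_span M)
  simpa using h

theorem coords_kClass (P : FGModuleCat.{u} A) (hP : Module.Projective A P) :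
    (((coords (fun l : SimpleClass A => kClass (projMod l) (projMod_projective l))
      (kClass P hP)).sum fun l k => k • kClass (projMod l) (projMod_projective l)) =
      kClass P hP) ∧
    ∀ l, coords (fun l : SimpleClass A => kClass (projMod l) (projMod_projective l))
      (kClass P hP) l = homDim P (simpleMod l) := by
  classical
  have h := coords_spec
    (fun l => kLift (fun P => homDim P (simpleMod l)) fun _ _ _ e => homDim_eq_add_of_prod e _)
    (fun i j => by simp [homDim_projMod_simpleMod, eq_comm]) (kClass_mem_span P hP)
  simpa using h

/-- There are finitely many simple modules: all of them occur in the finite expansion of `[A]` in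
terms of the `[P^μ]`, because `dim Hom(A, L^μ) = dim L^μ` is positive. -/
instance finite_simpleClass : Finite (SimpleClass A) := by
  let P := FGModuleCat.of A A
  have hP : Module.Projective A P := inferInstanceAs (Module.Projective A A)
  let c := coords (fun l : SimpleClass A => kClass (projMod l) (projMod_projective l))
      (kClass P hP)
  refine Set.finite_univ_iff.1 (c.support.finite_toSet.subset fun l _ => ?_)
  rw [Finset.mem_coe, Finsupp.mem_support_iff, (coords_kClass P hP).2 l, homDim_self]
  exact_mod_cast (dimC_simpleMod_pos l).ne'

instance fintype_simpleClass : Fintype (SimpleClass A) := Fintype.ofFinite _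

theorem dimC_eq_sum_simpleMod (M : FGModuleCat.{u} A) :
    dimC M = ∑ l : SimpleClass A, homDim (projMod l) M * dimC (simpleMod l) := by
  obtain ⟨h, hc⟩ := coords_gClass M
  have := congrArg (gLift dimC fun _ _ _ _ _ => dimC_eq_add_of_exact) h
  rw [Finsupp.sum_fintype _ _ (by simp), map_sum] at this
  simp only [map_zsmul, gLift_gClass, hc, smul_eq_mul] at this
  exact_mod_cast this.symm

theorem dimC_eq_sum_projMod (P : FGModuleCat.{u} A) (hP : Module.Projective A P) :
    dimC P = ∑ l : SimpleClass A, homDim P (simpleMod l) * dimC (projMod l) := by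
  obtain ⟨h, hc⟩ := coords_kClass P hP
  have := congrArg (kLift dimC fun _ _ _ e => dimC_eq_add_of_prod e) h
  rw [Finsupp.sum_fintype _ _ (by simp), map_sum] at this
  simp only [map_zsmul, kLift_kClass, hc, smul_eq_mul] at this
  exact_mod_cast this.symm

theorem finrank_eq_sum_simpleClass :
    Module.finrank ℂ A = ∑ l : SimpleClass A, dimC (simpleMod l) * dimC (projMod l) := by
  have h := dimC_eq_sum_projMod (FGModuleCat.of A A) (inferInstanceAs (Module.Projective A A))
  simp only [homDim_self] at h
  rw [← h, dimC_of]

end Grothendieck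

/-! ### Induction and restriction -/

section IndRes

variable {A B : Type u} [Ring A] [Ring B]

theorem indMap_add {φ : A →+* B} {M N : Type u} [AddCommGroup M] [Module A M] [AddCommGroup N]
    [Module A N] (f g : M →ₗ[A] N) : indMap φ (f + g) = indMap φ f + indMap φ g :=
  ind_hom_ext fun m => by simp [indTmul_add]

theorem indMap_comp {φ : A →+* B} {M N K : Type u} [AddCommGroup M] [Module A M] [AddCommGroup N]
    [Module A N] [AddCommGroup K] [Module A K] (g : N →ₗ[A] K) (f : M →ₗ[A] N) :
    indMap φ (g ∘ₗ f) = indMap φ g ∘ₗ indMap φ f :=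
  ind_hom_ext fun m => by simp

theorem indMap_id {φ : A →+* B} {M : Type u} [AddCommGroup M] [Module A M] :
    indMap φ (LinearMap.id : M →ₗ[A] M) = LinearMap.id :=
  ind_hom_ext fun m => by simp

theorem indTmul_eq_smul (φ : A →+* B) {M : Type u} [AddCommGroup M] [Module A M] (b : B) (m : M) :
    indTmul φ b m = b • indTmul φ 1 m := by
  rw [smul_indTmul, mul_one]

theorem span_indTmul_one (φ : A →+* B) (M : Type u) [AddCommGroup M] [Module A M] :
    Submodule.span B (Set.range (indTmul φ 1 : M → IndMod φ M)) = ⊤ := by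
  rw [eq_top_iff]
  rintro x -
  obtain ⟨x, rfl⟩ := (balancedRel φ M).mkQ_surjective x
  induction x using TensorProduct.induction_on with
  | zero => simp
  | add x y hx hy => rw [map_add]; exact Submodule.add_mem _ hx hy
  | tmul b m =>
    have e : (balancedRel φ M).mkQ (b ⊗ₜ[ℤ] m) = b • indTmul φ 1 m := indTmul_eq_smul φ b m
    rw [e]
    exact Submodule.smul_mem _ _ (Submodule.subset_span ⟨m, rfl⟩)

theorem indMap_surjective {φ : A →+* B} {M N : Type u} [AddCommGroup M] [Module A M]
    [AddCommGroup N] [Module A N] {f : M →ₗ[A] N} (hf : Function.Surjective f) :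
    Function.Surjective (indMap φ f) := by
  rw [← LinearMap.range_eq_top, eq_top_iff, ← span_indTmul_one φ N, Submodule.span_le]
  rintro _ ⟨n, rfl⟩
  obtain ⟨m, rfl⟩ := hf n
  exact ⟨indTmul φ 1 m, indMap_one_tmul φ f m⟩

variable [Algebra ℂ A] [Algebra ℂ B]

theorem indTmul_one_complex_smul (φ : A →ₐ[ℂ] B) (M : FGModuleCat.{u} A) (c : ℂ) (m : M) :
    indTmul (φ : A →+* B) 1 (c • m) = c • indTmul (φ : A →+* B) 1 m := by
  rw [complexModule_smul_def, ← indTmul_balanced, one_mul, indTmul_eq_smul,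
    ← algebraMap_smul B c (indTmul (φ : A →+* B) 1 m)]
  exact congrArg (· • _) (φ.commutes c)

theorem indMap_smul (φ : A →ₐ[ℂ] B) {M N : FGModuleCat.{u} A} (c : ℂ) (f : M →ₗ[A] N) :
    indMap (φ : A →+* B) (c • f) = c • indMap (φ : A →+* B) f := by
  refine ind_hom_ext fun m => ?_
  rw [indMap_one_tmul, LinearMap.smul_apply, LinearMap.smul_apply, indMap_one_tmul,
    indTmul_one_complex_smul]

variable [FiniteDimensional ℂ B]

/-- A restricted module has the same elements. -/
def resEquiv (φ : A →ₐ[ℂ] B) (N : FGModuleCat.{u} B) : (res φ).obj N ≃+ N := AddEquiv.refl N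

theorem resEquiv_smul (φ : A →ₐ[ℂ] B) (N : FGModuleCat.{u} B) (a : A) (x : (res φ).obj N) :
    resEquiv φ N (a • x) = φ a • resEquiv φ N x := rfl

theorem resEquiv_complex_smul (φ : A →ₐ[ℂ] B) (N : FGModuleCat.{u} B) (c : ℂ)
    (x : (res φ).obj N) : resEquiv φ N (c • x) = c • resEquiv φ N x := by
  rw [complexModule_smul_def, resEquiv_smul, AlgHom.commutes]
  rfl

theorem dimC_res (φ : A →ₐ[ℂ] B) (N : FGModuleCat.{u} B) : dimC ((res φ).obj N) = dimC N :=
  LinearEquiv.finrank_eq { resEquiv φ N with map_smul' := resEquiv_complex_smul φ N }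

/-- Frobenius reciprocity `Hom_B(Ind M, N) ≅ Hom_A(M, Res N)`. -/
def indResEquiv (φ : A →ₐ[ℂ] B) (M : FGModuleCat.{u} A) (N : FGModuleCat.{u} B) :
    ((ind (φ : A →+* B)).obj M →ₗ[B] N) ≃ₗ[ℂ] (M →ₗ[A] (res φ).obj N) where
  toFun f :=
    { toFun := fun m => (resEquiv φ N).symm (f (indTmul (φ : A →+* B) 1 m))
      map_add' := fun m m' => by
        rw [indTmul_add, ← map_add]
        exact congrArg _ (map_add f _ _)
      map_smul' := fun a m => by
        rw [← indTmul_balanced, one_mul, indTmul_eq_smul]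
        exact congrArg _ (map_smul f _ _) }
  map_add' f g := rfl
  map_smul' c f := LinearMap.ext fun m => by
    apply (resEquiv φ N).injective
    rw [RingHom.id_apply, LinearMap.smul_apply, resEquiv_complex_smul]
    rfl
  invFun g := indLift (φ : A →+* B)
    { toFun := fun m => resEquiv φ N (g m)
      map_add' := fun m m' => by rw [map_add, map_add]
      map_smul' := fun a m => by rw [map_smul, resEquiv_smul]; rfl }
  left_inv f := ind_hom_ext (M := M) (F := N) fun m => by
    rw [indLift_tmul, one_smul]
    rfl
  right_inv g := LinearMap.ext fun m => by
    apply (resEquiv φ N).injective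
    refine (indLift_tmul (φ : A →+* B) _ 1 m).trans ?_
    rw [one_smul]
    rfl

theorem homDim_ind (φ : A →ₐ[ℂ] B) (M : FGModuleCat.{u} A) (N : FGModuleCat.{u} B) :
    homDim ((ind (φ : A →+* B)).obj M) N = homDim M ((res φ).obj N) :=
  (indResEquiv φ M N).finrank_eq

/-! ### Frobenius extensions -/

/-- Morphisms in `FGModuleCat` are linear maps. -/
def homEquivLinearMap (M N : FGModuleCat.{u} A) : (M ⟶ N) ≃ (M →ₗ[A] N) where
  toFun f := f.hom.hom
  invFun f := FGModuleCat.ofHom f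

/-- The unit `P → Ind (Res P)` of an adjunction `Res ⊣ Ind`, as a linear map. -/
def frobeniusUnit {φ : A →ₐ[ℂ] B} (adj : res φ ⊣ ind (φ : A →+* B)) (P : FGModuleCat.{u} B) :
    P →ₗ[B] IndMod (φ : A →+* B) ((res φ).obj P) :=
  (adj.unit.app P).hom.hom

/-- The correspondence `Hom_A(Res P, M) → Hom_B(P, Ind M)` of an adjunction `Res ⊣ Ind`,
expressed through the unit, which makes its complex linearity visible. -/
def frobeniusHom {φ : A →ₐ[ℂ] B} (adj : res φ ⊣ ind (φ : A →+* B)) (P : FGModuleCat.{u} B)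
    (M : FGModuleCat.{u} A) :
    ((res φ).obj P →ₗ[A] M) →ₗ[ℂ] (P →ₗ[B] IndMod (φ : A →+* B) M) where
  toFun f := indMap (φ : A →+* B) f ∘ₗ frobeniusUnit adj P
  map_add' f g := by rw [indMap_add, LinearMap.add_comp]
  map_smul' c f := by rw [indMap_smul, LinearMap.smul_comp, RingHom.id_apply]

theorem frobeniusHom_bijective {φ : A →ₐ[ℂ] B} (adj : res φ ⊣ ind (φ : A →+* B))
    (P : FGModuleCat.{u} B) (M : FGModuleCat.{u} A) :
    Function.Bijective (frobeniusHom adj P M) := by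
  have h : ⇑(frobeniusHom adj P M) = ((homEquivLinearMap ((res φ).obj P) M).symm.trans
      ((adj.homEquiv P M).trans (homEquivLinearMap P ((ind (φ : A →+* B)).obj M)))) := by
    funext f
    change _ = (adj.homEquiv P M ((homEquivLinearMap ((res φ).obj P) M).symm f)).hom.hom
    rw [Adjunction.homEquiv_unit]
    rfl
  rw [h]
  exact Equiv.bijective _

theorem homDim_res {φ : A →ₐ[ℂ] B} (hφ : IsFrobeniusExtension φ) (P : FGModuleCat.{u} B)
    (M : FGModuleCat.{u} A) :
    homDim ((res φ).obj P) M = homDim P ((ind (φ : A →+* B)).obj M) :=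
  have ⟨adj⟩ := hφ
  (LinearEquiv.ofBijective _ (frobeniusHom_bijective adj P M)).finrank_eq.trans
    (homDim_of P (IndMod (φ : A →+* B) M)).symm

/-- Restriction along a Frobenius extension preserves projectivity, since its right adjoint,
induction, preserves surjections. -/
theorem res_projective {φ : A →ₐ[ℂ] B} (hφ : IsFrobeniusExtension φ) (P : FGModuleCat.{u} B)
    (hP : Module.Projective B P) : Module.Projective A ((res φ).obj P) := by
  obtain ⟨adj⟩ := hφ
  obtain ⟨n, q, hq⟩ := Module.Finite.exists_fin' A ((res φ).obj P)
  let F : FGModuleCat.{u} A := FGModuleCat.of A (Fin n → A)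
  -- lift the unit along `Ind q` and pass back through the adjunction to split `q`
  obtain ⟨t, ht⟩ := Module.projective_lifting_property (indMap (φ : A →+* B) q)
    (frobeniusUnit adj P) (indMap_surjective hq)
  obtain ⟨s, hs⟩ := (frobeniusHom_bijective adj P F).2 t
  let s' : (res φ).obj P →ₗ[A] (Fin n → A) := s
  have hs' : indMap (φ : A →+* B) s' ∘ₗ frobeniusUnit adj P = t := hs
  refine Module.Projective.of_split s' q ((frobeniusHom_bijective adj P _).1 ?_)
  change indMap (φ : A →+* B) (q ∘ₗ s') ∘ₗ frobeniusUnit adj P =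
    indMap (φ : A →+* B) LinearMap.id ∘ₗ frobeniusUnit adj P
  rw [indMap_comp, indMap_id, LinearMap.comp_assoc, hs', ht, LinearMap.id_comp]

end IndRes

/-! ### Dimension of an induced module -/

section FreeExtension

variable {A B : Type u} [Ring A] [Algebra ℂ A] [FiniteDimensional ℂ A] [Ring B] [Algebra ℂ B]

/-- Expanding the left factor in a basis `(b_i)` of `B` over `Aᵐᵒᵖ` identifies `B ⊗_A M` with
`M^ι`. -/
theorem dimC_ind_of_basis (φ : A →ₐ[ℂ] B) [Module Aᵐᵒᵖ B]
    (hsmul : ∀ (a : A) (b : B), MulOpposite.op a • b = b * φ a) {ι : Type*} [Fintype ι]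
    (b : Module.Basis ι Aᵐᵒᵖ B) (M : FGModuleCat.{u} A) :
    dimC ((ind (φ : A →+* B)).obj M) = Fintype.card ι * dimC M := by
  let ψ : (ι → M) →ₗ[ℂ] IndMod (φ : A →+* B) M :=
    { toFun := fun m => ∑ i, b i • indTmul (φ : A →+* B) 1 (m i)
      map_add' := fun m m' => by
        simp only [Pi.add_apply, indTmul_add, smul_add, Finset.sum_add_distrib]
      map_smul' := fun c m => by
        simp only [Pi.smul_apply, indTmul_one_complex_smul, RingHom.id_apply, Finset.smul_sum]
        exact Finset.sum_congr rfl fun i _ => smul_comm _ _ _ }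
  -- the coordinate map `b ⊗ m ↦ (i ↦ b_i^*(b) m)`, which vanishes on the balancing relations
  let g : B ⊗[ℤ] M →+ (ι → M) := TensorProduct.liftAddHom
    { toFun := fun x =>
        { toFun := fun m i => (b.repr x i).unop • m
          map_zero' := by ext i; simp
          map_add' := fun m m' => by ext i; simp }
      map_zero' := by ext m i; simp
      map_add' := fun x y => by ext m i; simp [add_smul] }
    (fun r x m => by
      ext i
      change (b.repr (r • x) i).unop • m = (b.repr x i).unop • r • m
      rw [map_zsmul, Finsupp.smul_apply, MulOpposite.unop_smul, smul_assoc, smul_comm])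
  have hg : ∀ x m i, g (x ⊗ₜ[ℤ] m) i = (b.repr x i).unop • m := fun x m i => by simp [g]
  have hrel : ∀ x ∈ balancedRel (φ : A →+* B) M, g x = 0 := by
    intro x hx
    refine Submodule.closure_induction (p := fun x _ => g x = 0) (map_zero g)
      (fun x y _ _ hx hy => by rw [map_add, hx, hy, add_zero]) ?_ hx
    rintro c _ ⟨y, a, m, rfl⟩
    rw [smul_sub, TensorProduct.smul_tmul', TensorProduct.smul_tmul', map_sub, sub_eq_zero]
    ext i
    have : c • (y * (φ : A →+* B) a) = MulOpposite.op a • (c • y) := by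
      rw [hsmul, smul_eq_mul, smul_eq_mul, mul_assoc]
      rfl
    rw [hg, hg, this, map_smul, Finsupp.smul_apply, smul_eq_mul, MulOpposite.unop_mul,
      MulOpposite.unop_op, mul_smul]
  have hinj : Function.Injective ψ := by
    rw [injective_iff_map_eq_zero]
    intro m hm
    have hmk : ψ m = (balancedRel (φ : A →+* B) M).mkQ (∑ i, b i ⊗ₜ[ℤ] m i) := by
      rw [map_sum]
      exact Finset.sum_congr rfl fun i _ => (indTmul_eq_smul (φ : A →+* B) (b i) (m i)).symm
    have h0 := hrel _ ((Submodule.Quotient.mk_eq_zero _).1 (hmk.symm.trans hm))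
    classical
    ext j
    have := congrFun h0 j
    rw [map_sum, Finset.sum_apply] at this
    simpa [hg, Finsupp.single_apply, apply_ite, ite_smul] using this
  have hsurj : Function.Surjective ψ := by
    intro x
    obtain ⟨x, rfl⟩ := (balancedRel (φ : A →+* B) M).mkQ_surjective x
    induction x using TensorProduct.induction_on with
    | zero => exact ⟨0, (map_zero ψ).trans (map_zero (Submodule.mkQ _)).symm⟩
    | add x y hx hy =>
      obtain ⟨m, hm⟩ := hx
      obtain ⟨m', hm'⟩ := hy
      exact ⟨m + m', by rw [map_add, map_add, hm, hm']⟩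
    | tmul y m =>
      refine ⟨fun i => (b.repr y i).unop • m, ?_⟩
      have hy : y = ∑ i, b i * φ (b.repr y i).unop := by
        conv_lhs => rw [← b.sum_repr y]
        exact Finset.sum_congr rfl fun i _ => hsmul (b.repr y i).unop (b i)
      refine Eq.trans ?_ (indTmul_eq_smul (φ : A →+* B) y m).symm
      conv_rhs => rw [hy, Finset.sum_smul]
      refine Finset.sum_congr rfl fun i _ => ?_
      rw [← indTmul_balanced, one_mul, indTmul_eq_smul, ← mul_smul]
      rfl
  have hdim := dimC_of (A := B) (IndMod (φ : A →+* B) M)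
  rw [← (LinearEquiv.ofBijective ψ ⟨hinj, hsurj⟩).finrank_eq, Module.finrank_pi_fintype,
    Finset.sum_const, Finset.card_univ, smul_eq_mul] at hdim
  exact hdim

theorem finrank_mul_dimC_ind [FiniteDimensional ℂ B] {φ : A →ₐ[ℂ] B} (hφ : IsRightFree φ)
    (M : FGModuleCat.{u} A) :
    Module.finrank ℂ A * dimC ((ind (φ : A →+* B)).obj M) = Module.finrank ℂ B * dimC M := by
  let _ : Module Aᵐᵒᵖ B := Module.compHom B (φ : A →+* B).op
  have hfree : Module.Free Aᵐᵒᵖ B := hφ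
  have hsmul : ∀ (a : A) (b : B), MulOpposite.op a • b = b * φ a := fun a b => rfl
  have hst : IsScalarTower ℂ Aᵐᵒᵖ B := ⟨fun c a b => by
    obtain ⟨a, rfl⟩ := MulOpposite.op_surjective a
    rw [← MulOpposite.op_smul, hsmul, hsmul, map_smul, mul_smul_comm]⟩
  have : Module.Finite Aᵐᵒᵖ B := Module.Finite.of_restrictScalars_finite ℂ Aᵐᵒᵖ B
  let b := Module.Free.chooseBasis Aᵐᵒᵖ B
  have hB : Module.finrank ℂ B =
      Fintype.card (Module.Free.ChooseBasisIndex Aᵐᵒᵖ B) * Module.finrank ℂ A := by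
    rw [(b.equivFun.restrictScalars ℂ).finrank_eq, Module.finrank_pi_fintype, Finset.sum_const,
      Finset.card_univ, smul_eq_mul, ← (MulOpposite.opLinearEquiv ℂ : A ≃ₗ[ℂ] Aᵐᵒᵖ).finrank_eq]
  rw [dimC_ind_of_basis φ hsmul b M, hB]
  ring

end FreeExtension

namespace Tower

variable (T : Tower.{u})

/-! ### Branching coefficients of a tower -/

section Branching

variable {T} {n : ℕ}

theorem kappaStep_apply (μ : SimpleClass (T.A n)) (l : SimpleClass (T.A (n + 1))) :
    T.kappaStep μ l = homDim ((T.indStep n).obj (projMod μ)) (simpleMod l) :=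
  (coords_kClass _ (T.ind_projMod_projective μ)).2 l

theorem kappaStarStep_apply (μ : SimpleClass (T.A n)) (l : SimpleClass (T.A (n + 1))) :
    T.kappaStarStep μ l = homDim (projMod l) ((T.indStep n).obj (simpleMod μ)) :=
  (coords_gClass ((T.indStep n).obj (simpleMod μ))).2 l

/-- By Frobenius reciprocity `κ(μ, l)` is the multiplicity of `L^μ` in `Res L^l`. -/
theorem sum_kappaStep_mul_dimC_simpleMod (l : SimpleClass (T.A (n + 1))) :
    ∑ μ, T.kappaStep μ l * dimC (simpleMod μ) = dimC (simpleMod l) := by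
  simp only [kappaStep_apply, homDim_ind]
  rw [← dimC_res (T.incl n), dimC_eq_sum_simpleMod ((res (T.incl n)).obj (simpleMod l))]
  push_cast
  rfl

/-- By the adjunction `Res ⊣ Ind`, `κ^*(μ, l)` is the multiplicity of `P^μ` in the projective
module `Res P^l`. -/
theorem sum_kappaStarStep_mul_dimC_projMod (hT : T.IsFreeFrobenius)
    (l : SimpleClass (T.A (n + 1))) :
    ∑ μ, T.kappaStarStep μ l * dimC (projMod μ) = dimC (projMod l) := by
  simp only [kappaStarStep_apply, ← homDim_res (hT n).1]
  rw [← dimC_res (T.incl n), dimC_eq_sum_projMod ((res (T.incl n)).obj (projMod l))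
    (res_projective (hT n).1 _ (projMod_projective l))]
  push_cast
  rfl

theorem finrank_mul_sum_kappaStep (hT : T.IsFreeFrobenius) (μ : SimpleClass (T.A n)) :
    Module.finrank ℂ (T.A n) * ∑ l, T.kappaStep μ l * dimC (projMod l) =
      Module.finrank ℂ (T.A (n + 1)) * dimC (projMod μ) := by
  simp only [kappaStep_apply]
  have h := finrank_mul_dimC_ind (hT n).2 (projMod μ)
  rw [dimC_eq_sum_projMod _ (T.ind_projMod_projective μ)] at h
  exact_mod_cast h

theorem finrank_mul_sum_kappaStarStep (hT : T.IsFreeFrobenius) (μ : SimpleClass (T.A n)) :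
    Module.finrank ℂ (T.A n) * ∑ l, T.kappaStarStep μ l * dimC (simpleMod l) =
      Module.finrank ℂ (T.A (n + 1)) * dimC (simpleMod μ) := by
  simp only [kappaStarStep_apply]
  have h := finrank_mul_dimC_ind (hT n).2 (simpleMod μ)
  rw [dimC_eq_sum_simpleMod] at h
  exact_mod_cast h

@[simp]
theorem kappa_mk (μ : SimpleClass (T.A n)) (l : SimpleClass (T.A (n + 1))) :
    T.kappa ⟨n, μ⟩ ⟨n + 1, l⟩ = T.kappaStep μ l := by
  simp [kappa]

@[simp]
theorem kappaStar_mk (μ : SimpleClass (T.A n)) (l : SimpleClass (T.A (n + 1))) :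
    T.kappaStar ⟨n, μ⟩ ⟨n + 1, l⟩ = T.kappaStarStep μ l := by
  simp [kappaStar]

theorem kappa_nonneg (μ l : T.Gam) : 0 ≤ T.kappa μ l := by
  unfold kappa
  split_ifs
  · rw [kappaStep_apply]
    exact Int.natCast_nonneg _
  · exact le_rfl

theorem kappaStar_nonneg (μ l : T.Gam) : 0 ≤ T.kappaStar μ l := by
  unfold kappaStar
  split_ifs
  · rw [kappaStarStep_apply]
    exact Int.natCast_nonneg _
  · exact le_rfl

theorem rank_eq_of_kappa_pos (μ l : T.Gam) (h : 0 < T.kappa μ l) : l.1 = μ.1 + 1 := by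
  by_contra hne
  simp [kappa, hne] at h

theorem rank_eq_of_kappaStar_pos (μ l : T.Gam) (h : 0 < T.kappaStar μ l) : l.1 = μ.1 + 1 := by
  by_contra hne
  simp [kappaStar, hne] at h

end Branching

/-! ### Coherence from branching identities -/

section Coherence

/-- The graded graph on `Γ` with an edge from `μ` to `l` when the branching coefficient `k μ l` is
positive; `graph` and `graphStar` are the cases `k = κ` and `k = κ^*`. -/
def branchingGraph (k : T.Gam → T.Gam → ℤ) (hk : ∀ μ l, 0 < k μ l → l.1 = μ.1 + 1) :
    GradedGraph where
  V := T.Gam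
  rank μ := μ.1
  mult μ l := if 0 < k μ l then 1 else 0
  rank_eq μ l h := by
    rw [hk μ l (by by_contra h'; simp [h'] at h)]
    push_cast
    rfl

variable {T} {k : T.Gam → T.Gam → ℤ} {hk : ∀ μ l, 0 < k μ l → l.1 = μ.1 + 1}

theorem hasSum_comp (n : ℕ) (f : (T.branchingGraph k hk).comp n → ℝ) :
    HasSum f (∑ μ : SimpleClass (T.A n), f ⟨⟨n, μ⟩, rfl⟩) := by
  let e : SimpleClass (T.A n) → (T.branchingGraph k hk).comp n := fun μ => ⟨⟨n, μ⟩, rfl⟩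
  have he : Function.Bijective e := by
    constructor
    · intro μ η h
      exact eq_of_heq (Sigma.mk.inj (congrArg Subtype.val h)).2
    · rintro ⟨⟨m, μ⟩, hm⟩
      obtain rfl : m = n := Int.natCast_inj.1 hm
      exact ⟨μ, rfl⟩
  exact (Equiv.hasSum_iff (Equiv.ofBijective e he)).1 (hasSum_fintype _)

/-- The down transition function attached to branching coefficients `k` and dimensions `d` that
satisfy `∑_μ k(μ, l) d(μ) = d(l)`. -/
theorem isDownTransition_branchingGraph {d : T.Gam → ℕ} (hnn : ∀ μ l, 0 ≤ k μ l)
    (hd : ∀ μ, 0 < d μ)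
    (hdown : ∀ n (l : SimpleClass (T.A (n + 1))),
      ∑ μ : SimpleClass (T.A n), k ⟨n, μ⟩ ⟨n + 1, l⟩ * d ⟨n, μ⟩ = d ⟨n + 1, l⟩) :
    (T.branchingGraph k hk).IsDownTransition
      (fun l μ : T.Gam => (k μ l : ℝ) * d μ / d l) where
  mem_Icc l μ := by
    have hl : (0 : ℝ) < d l := by exact_mod_cast hd l
    have hk0 : (0 : ℝ) ≤ k μ l := by exact_mod_cast hnn μ l
    refine ⟨by positivity, ?_⟩
    rw [div_le_one hl]
    by_cases h : 0 < k μ l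
    · obtain ⟨n, μ⟩ := μ
      obtain ⟨m, l⟩ := l
      obtain rfl : m = n + 1 := hk _ _ h
      have := Finset.single_le_sum
        (f := fun η : SimpleClass (T.A n) => k ⟨n, η⟩ ⟨n + 1, l⟩ * d ⟨n, η⟩)
        (fun η _ => mul_nonneg (hnn _ _) (Int.natCast_nonneg _)) (Finset.mem_univ μ)
      rw [hdown] at this
      exact_mod_cast this
    · rw [le_antisymm (not_lt.1 h) (hnn _ _)]
      simp
  pos_iff l μ := by
    have hl : (0 : ℝ) < d l := by exact_mod_cast hd l
    have hμ : (0 : ℝ) < d μ := by exact_mod_cast hd μ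
    rw [div_pos_iff_of_pos_right hl, mul_pos_iff_of_pos_right hμ, Int.cast_pos]
    constructor
    · intro h
      refine ⟨μ.1, ?_, rfl, ?_⟩
      · change (l.1 : ℤ) = _
        rw [hk _ _ h]
        push_cast
        rfl
      · simp [branchingGraph, h]
    · rintro ⟨n, -, -, h⟩
      by_contra h'
      simp [branchingGraph, h'] at h
  sum_eq_one n l hl := by
    obtain ⟨m, l⟩ := l
    obtain rfl : m = n + 1 := by
      change (m : ℤ) = n + 1 at hl
      exact_mod_cast hl
    convert hasSum_comp n _ using 1
    have h0 : (d ⟨n + 1, l⟩ : ℝ) ≠ 0 := by exact_mod_cast (hd _).ne'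
    rw [← Finset.sum_div, eq_comm, div_eq_one_iff_eq h0]
    exact_mod_cast hdown n l

/-- The Plancherel weights `d d' / dim A_n` are coherent when `d` is preserved by the branching
coefficients going down, and `d'` is scaled by `dim A_{n+1} / dim A_n` going up. -/
theorem isCoherent_branchingGraph {d d' : T.Gam → ℕ} (hnn : ∀ μ l, 0 ≤ k μ l)
    (hd : ∀ μ, 0 < d μ) (hd' : ∀ μ, 0 < d' μ)
    (hdown : ∀ n (l : SimpleClass (T.A (n + 1))),
      ∑ μ : SimpleClass (T.A n), k ⟨n, μ⟩ ⟨n + 1, l⟩ * d ⟨n, μ⟩ = d ⟨n + 1, l⟩)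
    (hup : ∀ n (μ : SimpleClass (T.A n)),
      Module.finrank ℂ (T.A n) *
        ∑ l : SimpleClass (T.A (n + 1)), k ⟨n, μ⟩ ⟨n + 1, l⟩ * d' ⟨n + 1, l⟩ =
      Module.finrank ℂ (T.A (n + 1)) * d' ⟨n, μ⟩)
    (htotal : ∀ n, ∑ μ : SimpleClass (T.A n), d ⟨n, μ⟩ * d' ⟨n, μ⟩ = Module.finrank ℂ (T.A n)) :
    (T.branchingGraph k hk).IsCoherent (fun l μ : T.Gam => (k μ l : ℝ) * d μ / d l)
      (fun _ μ => (d μ.1 : ℝ) * d' μ.1 / Module.finrank ℂ (T.A μ.1.1)) := by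
  have hA : ∀ n, 0 < Module.finrank ℂ (T.A n) := fun n => by
    have : Nontrivial (T.A n) := by
      induction n with
      | zero => exact (Equiv.ofBijective _ T.zero_eq).symm.nontrivial
      | succ n ih => exact (T.incl_injective n).nontrivial
    exact Module.finrank_pos
  have hpos : ∀ μ : T.Gam, (0 : ℝ) < (d μ : ℝ) * d' μ / Module.finrank ℂ (T.A μ.1) := fun μ => by
    have h1 := hA μ.1
    have h2 := hd μ
    have h3 := hd' μ
    positivity
  refine ⟨isDownTransition_branchingGraph hnn hd hdown, fun n => ⟨fun μ => (hpos μ.1).le, ?_⟩,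
    fun n μ => hpos μ.1, ?_⟩
  · convert hasSum_comp n _ using 1
    have h0 : (Module.finrank ℂ (T.A n) : ℝ) ≠ 0 := by exact_mod_cast (hA n).ne'
    change 1 = ∑ μ : SimpleClass (T.A n),
      (d ⟨n, μ⟩ : ℝ) * d' ⟨n, μ⟩ / Module.finrank ℂ (T.A n)
    rw [← Finset.sum_div, eq_comm, div_eq_one_iff_eq h0]
    exact_mod_cast htotal n
  · rintro n ⟨⟨m, μ⟩, hm⟩
    obtain rfl : m = n := Int.natCast_inj.1 hm
    convert hasSum_comp (m + 1) _ using 1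
    have h0 : (Module.finrank ℂ (T.A m) : ℝ) ≠ 0 := by exact_mod_cast (hA m).ne'
    have h1 : (Module.finrank ℂ (T.A (m + 1)) : ℝ) ≠ 0 := by exact_mod_cast (hA (m + 1)).ne'
    have hup' : (Module.finrank ℂ (T.A m) : ℝ) *
        ∑ l : SimpleClass (T.A (m + 1)), (k ⟨m, μ⟩ ⟨m + 1, l⟩ : ℝ) * d' ⟨m + 1, l⟩ =
        Module.finrank ℂ (T.A (m + 1)) * d' ⟨m, μ⟩ := by
      exact_mod_cast hup m μ
    trans (d ⟨m, μ⟩ : ℝ) / Module.finrank ℂ (T.A (m + 1)) *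
        ∑ l : SimpleClass (T.A (m + 1)), (k ⟨m, μ⟩ ⟨m + 1, l⟩ : ℝ) * d' ⟨m + 1, l⟩
    · field_simp
      linear_combination -(d ⟨m, μ⟩ : ℝ) * hup'
    · rw [Finset.mul_sum]
      refine Finset.sum_congr rfl fun l _ => ?_
      have h2 : (d ⟨m + 1, l⟩ : ℝ) ≠ 0 := by exact_mod_cast (hd _).ne'
      field_simp

end Coherence

end Tower

end FrobTower

end

theorem mainTheorem1 (T : FrobTower.Tower.{u}) (hT : T.IsFreeFrobenius) :
    T.graph.IsCoherent T.pDown (fun _ μ => T.Pl μ.1) ∧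
      T.graphStar.IsCoherent T.pDownStar (fun _ μ => T.Pl μ.1) := by
  have hL : ∀ μ : T.Gam, 0 < T.dimL μ := fun μ => FrobTower.dimC_simpleMod_pos μ.2
  have hP : ∀ μ : T.Gam, 0 < T.dimP μ := fun μ => FrobTower.dimC_pos (FrobTower.projMod μ.2)
  constructor
  · refine FrobTower.Tower.isCoherent_branchingGraph (k := T.kappa)
      (hk := FrobTower.Tower.rank_eq_of_kappa_pos) (d := T.dimL) (d' := T.dimP)
      FrobTower.Tower.kappa_nonneg hL hP (fun n l => ?_) (fun n μ => ?_)
      fun n => FrobTower.finrank_eq_sum_simpleClass.symm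
    · simp only [FrobTower.Tower.kappa_mk]
      exact FrobTower.Tower.sum_kappaStep_mul_dimC_simpleMod l
    · simp only [FrobTower.Tower.kappa_mk]
      exact FrobTower.Tower.finrank_mul_sum_kappaStep hT μ
  · -- the same weights, with the roles of `L` and `P` exchanged
    have hPl : T.Pl = fun μ => (T.dimP μ : ℝ) * T.dimL μ / Module.finrank ℂ (T.A μ.1) :=
      funext fun μ => by rw [FrobTower.Tower.Pl, mul_comm (T.dimL μ : ℝ)]
    rw [hPl]
    refine FrobTower.Tower.isCoherent_branchingGraph (k := T.kappaStar)
      (hk := FrobTower.Tower.rank_eq_of_kappaStar_pos) (d := T.dimP) (d' := T.dimL)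
      FrobTower.Tower.kappaStar_nonneg hP hL (fun n l => ?_) (fun n μ => ?_) fun n => ?_
    · simp only [FrobTower.Tower.kappaStar_mk]
      exact FrobTower.Tower.sum_kappaStarStep_mul_dimC_projMod hT l
    · simp only [FrobTower.Tower.kappaStar_mk]
      exact FrobTower.Tower.finrank_mul_sum_kappaStarStep hT μ
    · simp only [mul_comm (T.dimP _)]
      exact FrobTower.finrank_eq_sum_simpleClass.symm
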